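/- For a group $G$ generated by a finite set $S$, let $\ell_{G,S}(g)$ be the least length of a product of elements of $S\cup S^{-1}$ equal to $g\in G$, let $F_{G,S}(n)$ be the number of $g\in G$ with $\ell_{G,S}(g)\le n$, and let $$\omega(G,S)=\lim_{n\to\infty}F_{G,S}(n)^{1/n}$$ be the exponential growth rate of $G$ with respect to $S$. The minimal growth rate of $G$ is $\Omega(G)=\inf_S\omega(G,S)$, where $S$ runs over all finite generating sets of $G$. **Corollary 3.** Let $\mathbb Z\wr\mathbb Z=\bigl(\bigoplus_{\mathbb Z}\mathbb Z\bigr)\rtimes\mathbb Z$ be the restricted wreath product, let $t$ be the generator $1$ of the acting group $\mathbb Z$ (which acts by shifting coordinates), and let $a$ be the generator $1$ of the copy of $\mathbb Z$ at coordinate $0$. With respect to these elements, $$\mathbb Z\wr\mathbb Z=\langle a,t\mid [t^k a t^{-k},a]=1\ (k=1,2,\dots)\rangle .$$ For every finite generating set $S$ of $\mathbb Z\wr\mathbb Z$ the limit $\omega(\mathbb Z\wr\mathbb Z,S)$ exists, and the minimal growth rate is realized on the generating set $\{a,t\}$: $$\Omega(\mathbb Z\wr\mathbb Z)=\omega(\mathbb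 Z\wr\mathbb Z,\{a,t\})=1+\sqrt2 .$$ -/

import Mathlib

open Filter Topology
open scoped commutatorElement

noncomputable section

/-- The word length of `g` with respect to `S`: the least length of a product of elements of
`S ∪ S⁻¹` that is equal to `g`. -/
def wordLength {G : Type*} [Group G] (S : Set G) (g : G) : ℕ :=
  sInf {n : ℕ | ∃ l : List G, (∀ x ∈ l, x ∈ S ∨ x⁻¹ ∈ S) ∧ l.prod = g ∧ l.length = n}

/-- The growth function: the number of elements in the ball of radius `n` about the identity.
It is meant for finite sets `S` that generate `G`. -/
def growthFunction {G : Type*} [Group G] (S : Set G) (n : ℕ) : ℕ :=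
  Set.ncard {g : G | wordLength S g ≤ n}

/-- The exponential growth rate `ω(G, S)`, the limit of the `n`-th roots of the growth function. -/
def growthRate {G : Type*} [Group G] (S : Set G) : ℝ :=
  limUnder atTop (fun n : ℕ => (growthFunction S n : ℝ) ^ (1 / (n : ℝ)))

/-- The minimal growth rate `Ω(G)`: the infimum of `ω(G, S)` over all finite generating sets. -/
def minimalGrowthRate (G : Type*) [Group G] : ℝ :=
  sInf {r : ℝ | ∃ S : Set G, S.Finite ∧ Subgroup.closure S = ⊤ ∧ growthRate S = r}

/-- The restricted wreath product of `D` and `Q`: the elements of the (unrestricted) regular wreath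
product whose component `Q → D` has finite support. -/
def restrictedWreathProduct (D Q : Type*) [Group D] [Group Q] : Subgroup (D ≀ᵣ Q) where
  carrier := {x | (Function.mulSupport x.left).Finite}
  one_mem' := by simp
  mul_mem' := by
    intro x y hx hy
    refine (hx.union (hy.preimage (f := fun q : Q => x.right⁻¹ * q)
      (mul_right_injective _).injOn)).subset ?_
    exact Function.mulSupport_mul x.left (fun q => y.left (x.right⁻¹ * q))
  inv_mem' := by
    intro x hx
    refine (hx.preimage (f := fun q : Q => x.right * q) (mul_right_injective _).injOn).subset ?_
    intro q hq
    simpa using hq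

/-- The restricted wreath product `ℤ ≀ ℤ`. -/
abbrev ZWrZ : Type := restrictedWreathProduct (Multiplicative ℤ) (Multiplicative ℤ)

namespace ZWrZ

/-- The generator of the copy of the base group `ℤ` at the position `0`. -/
def a : ZWrZ :=
  ⟨⟨Pi.mulSingle 1 (Multiplicative.ofAdd 1), 1⟩,
    (Set.finite_singleton 1).subset Pi.mulSupport_mulSingle_subset⟩

/-- The generator of the acting group `ℤ`. -/
def t : ZWrZ :=
  ⟨⟨1, Multiplicative.ofAdd 1⟩, by simp [restrictedWreathProduct]⟩

/-- The relators `[t ^ k * a * t ^ (-k), a]`, `k = 1, 2, …`, where `a` and `t` are the free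
generators `0` and `1`. -/
def relators : Set (FreeGroup (Fin 2)) :=
  {r | ∃ k : ℕ, 1 ≤ k ∧
    r = ⁅FreeGroup.of (1 : Fin 2) ^ k * FreeGroup.of (0 : Fin 2) * (FreeGroup.of (1 : Fin 2) ^ k)⁻¹,
      FreeGroup.of (0 : Fin 2)⁆}

end ZWrZ

end

/-!
Upper bound: an element of `ℤ ≀ ℤ` is a finitely supported vector together with a position, and a
word in `a`, `t` of length `N` representing it pays the `ℓ¹` norm of the vector for the letters `a`
and the length of a tour of its support for the letters `t`. Only polynomially many tours occur, and
the vectors supported on `d` points with `ℓ¹` norm at most `M` are counted by the coefficients of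
`((1 + z) / (1 - z)) ^ d / (1 - z)`. At `z = √2 - 1` the ratio `(1 + z) / (1 - z)` equals `z⁻¹`, so
that a point visited costs as much as a letter, and the count is at most `(1 + √2) ^ (d + M)`.

Lower bound: `ℤ ≀ ℤ` acts on the field of Laurent series `ℚ⸨X⸩` by the affine maps
`y ↦ X ^ n * y + b`. If `ω(G, S) < z⁻¹`, the measure `∑ z ^ ℓ(g) δ_{g x}` on an orbit is finite and
every generator changes it by a factor between `z` and `z⁻¹`. Up to inversion, two noncommuting
generators have, in a suitable coordinate, the form `y ↦ y + 1`, `y ↦ X ^ m * y` with `0 < m`, or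
`y ↦ X ^ k * y`, `y ↦ X ^ m * y + 1` with `0 < k ≤ m`. Comparing the measures of a ball, of its
images and of the shells between them then gives `(z ^ 2 + 2 * z - 1) * β ≤ 0`, where `β` is the
measure of the unit ball; if `√2 - 1 < z`, this forces `β = 0`, although the ball contains the base
point of the orbit.
-/

section Growth

variable {G : Type*} [Group G] {S : Set G}

lemma wordLength_prod_le {l : List G} (hl : ∀ x ∈ l, x ∈ S ∨ x⁻¹ ∈ S) :
    wordLength S l.prod ≤ l.length :=
  Nat.sInf_le ⟨l, hl, rfl, rfl⟩

lemma exists_word (hS : Subgroup.closure S = ⊤) (g : G) :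
    ∃ l : List G, (∀ x ∈ l, x ∈ S ∨ x⁻¹ ∈ S) ∧ l.prod = g ∧ l.length = wordLength S g := by
  have hg : g ∈ (Subgroup.closure S).toSubmonoid := hS ▸ Subgroup.mem_top g
  rw [Subgroup.closure_toSubmonoid] at hg
  obtain ⟨l, hl, hlg⟩ := Submonoid.exists_list_of_mem_closure hg
  exact Nat.sInf_mem
    (s := {n : ℕ | ∃ l : List G, (∀ x ∈ l, x ∈ S ∨ x⁻¹ ∈ S) ∧ l.prod = g ∧ l.length = n})
    ⟨l.length, l, hl, hlg, rfl⟩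

lemma wordLength_one : wordLength S (1 : G) = 0 :=
  Nat.le_zero.1 (wordLength_prod_le (l := []) (by simp))

lemma wordLength_mul_le_add_one (hS : Subgroup.closure S = ⊤) {s : G} (hs : s ∈ S ∨ s⁻¹ ∈ S)
    (g : G) : wordLength S (s * g) ≤ wordLength S g + 1 := by
  obtain ⟨l, hl, rfl, hlen⟩ := exists_word hS g
  rw [← hlen, ← List.prod_cons, ← List.length_cons (a := s)]
  exact wordLength_prod_le (by simpa using ⟨hs, hl⟩)

lemma finite_ball (hf : S.Finite) (hS : Subgroup.closure S = ⊤) (n : ℕ) :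
    {g : G | wordLength S g ≤ n}.Finite := by
  have : Finite {x : G // x ∈ S ∨ x⁻¹ ∈ S} := (hf.union hf.inv).to_subtype
  refine ((List.finite_length_le {x : G // x ∈ S ∨ x⁻¹ ∈ S} n).image
    fun l => (l.map Subtype.val).prod).subset fun g hg => ?_
  obtain ⟨l, hl, rfl, hlen⟩ := exists_word hS g
  rw [Set.mem_ofPred_eq, ← hlen] at hg
  lift l to List {x : G // x ∈ S ∨ x⁻¹ ∈ S} using hl
  exact ⟨l, by rwa [List.length_map] at hg, rfl⟩

lemma growthFunction_pos (hf : S.Finite) (hS : Subgroup.closure S = ⊤) (n : ℕ) :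
    0 < growthFunction S n :=
  (Set.ncard_pos (finite_ball hf hS n)).2 ⟨1, by simp [wordLength_one]⟩

open scoped Pointwise in
lemma ball_add_subset (hS : Subgroup.closure S = ⊤) (m n : ℕ) :
    {g : G | wordLength S g ≤ m + n} ⊆
      {g : G | wordLength S g ≤ m} * {g : G | wordLength S g ≤ n} := by
  intro g hg
  obtain ⟨l, hl, rfl, hlen⟩ := exists_word hS g
  rw [Set.mem_ofPred_eq, ← hlen] at hg
  refine ⟨(l.take m).prod, ?_, (l.drop m).prod, ?_, List.prod_take_mul_prod_drop l m⟩
  · exact (wordLength_prod_le fun x hx => hl x (List.mem_of_mem_take hx)).trans (by simp)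
  · exact (wordLength_prod_le fun x hx => hl x (List.mem_of_mem_drop hx)).trans
      (by rw [List.length_drop]; lia)

lemma growthFunction_add_le (hf : S.Finite) (hS : Subgroup.closure S = ⊤) (m n : ℕ) :
    growthFunction S (m + n) ≤ growthFunction S m * growthFunction S n :=
  (Set.ncard_le_ncard (ball_add_subset hS m n)
    ((finite_ball hf hS m).mul (finite_ball hf hS n))).trans Set.natCard_mul_le

theorem tendsto_growthRate (hf : S.Finite) (hS : Subgroup.closure S = ⊤) :
    Tendsto (fun n : ℕ => (growthFunction S n : ℝ) ^ (1 / (n : ℝ))) atTop (𝓝 (growthRate S)) := by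
  have hpos (n) : (0 : ℝ) < growthFunction S n := by exact_mod_cast growthFunction_pos hf hS n
  have hsub : Subadditive fun n => Real.log (growthFunction S n) := fun m n => by
    rw [← Real.log_mul (hpos m).ne' (hpos n).ne']
    exact Real.log_le_log (hpos _) (by exact_mod_cast growthFunction_add_le hf hS m n)
  have hbdd : BddBelow (Set.range fun n : ℕ => Real.log (growthFunction S n) / n) :=
    ⟨0, Set.forall_mem_range.2 fun _ => div_nonneg (Real.log_natCast_nonneg _) (Nat.cast_nonneg _)⟩
  refine tendsto_nhds_limUnder ⟨Real.exp hsub.lim, ?_⟩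
  refine ((Real.continuous_exp.tendsto _).comp (hsub.tendsto_lim hbdd)).congr fun n => ?_
  rw [Function.comp_apply, Real.rpow_def_of_pos (hpos n), mul_one_div]

lemma growthRate_nonneg (hf : S.Finite) (hS : Subgroup.closure S = ⊤) : 0 ≤ growthRate S :=
  ge_of_tendsto' (tendsto_growthRate hf hS) fun _ => Real.rpow_nonneg (Nat.cast_nonneg _) _

lemma eventually_growthFunction_le_pow (hf : S.Finite) (hS : Subgroup.closure S = ⊤) {w : ℝ}
    (hw : growthRate S < w) : ∀ᶠ n : ℕ in atTop, (growthFunction S n : ℝ) ≤ w ^ n := by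
  filter_upwards [(tendsto_growthRate hf hS).eventually_lt_const hw, eventually_ne_atTop 0]
    with n hn hn0
  have hpow := pow_le_pow_left₀ (Real.rpow_nonneg (Nat.cast_nonneg _) _) hn.le n
  rwa [one_div, Real.rpow_inv_natCast_pow (Nat.cast_nonneg _) hn0] at hpow

lemma eventually_pow_le_growthFunction (hf : S.Finite) (hS : Subgroup.closure S = ⊤) {w : ℝ}
    (hw0 : 0 ≤ w) (hw : w < growthRate S) :
    ∀ᶠ n : ℕ in atTop, w ^ n ≤ (growthFunction S n : ℝ) := by
  filter_upwards [(tendsto_growthRate hf hS).eventually_const_lt hw, eventually_ne_atTop 0]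
    with n hn hn0
  have hpow := pow_le_pow_left₀ hw0 hn.le n
  rwa [one_div, Real.rpow_inv_natCast_pow (Nat.cast_nonneg _) hn0] at hpow

lemma summable_growthFunction_mul_pow (hf : S.Finite) (hS : Subgroup.closure S = ⊤) {z : ℝ}
    (hz : 0 < z) (h : growthRate S < z⁻¹) :
    Summable fun n : ℕ => (growthFunction S n : ℝ) * z ^ n := by
  obtain ⟨w, hw, hwz⟩ := exists_between h
  have hw0 : 0 ≤ w := (growthRate_nonneg hf hS).trans hw.le
  have hwz1 : w * z < 1 := by rwa [← lt_div_iff₀ hz, one_div]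
  refine .of_norm_bounded_eventually_nat (g := fun n => (w * z) ^ n)
    (summable_geometric_of_lt_one (by positivity) hwz1) ?_
  filter_upwards [eventually_growthFunction_le_pow hf hS hw] with n hn
  rw [Real.norm_of_nonneg (by positivity), mul_pow]
  gcongr

theorem summable_pow_wordLength (hf : S.Finite) (hS : Subgroup.closure S = ⊤) {z : ℝ} (hz : 0 < z)
    (h : growthRate S < z⁻¹) : Summable fun g : G => z ^ wordLength S g := by
  classical
  have hsum := summable_growthFunction_mul_pow hf hS hz h
  refine summable_of_sum_le (c := ∑' n : ℕ, (growthFunction S n : ℝ) * z ^ n)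
    (fun g => by positivity) fun s => ?_
  have hsphere (n : ℕ) : (s.filter fun g => wordLength S g = n).card ≤ growthFunction S n := by
    rw [← Set.ncard_coe_finset]
    refine Set.ncard_le_ncard (fun g hg => ?_) (finite_ball hf hS n)
    exact (Finset.mem_filter.1 (Finset.mem_coe.1 hg)).2.le
  calc ∑ g ∈ s, z ^ wordLength S g
      = ∑ n ∈ s.image (wordLength S), (s.filter fun g => wordLength S g = n).card * z ^ n := by
        rw [Finset.sum_comp (fun n => z ^ n)]
        simp only [nsmul_eq_mul]
    _ ≤ ∑ n ∈ s.image (wordLength S), growthFunction S n * z ^ n := by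
        gcongr with n; exact hsphere n
    _ ≤ ∑' n : ℕ, growthFunction S n * z ^ n := hsum.sum_le_tsum _ fun n _ => by positivity

theorem growthRate_le_of_isBigO (hf : S.Finite) (hS : Subgroup.closure S = ⊤) {w : ℝ} (hw : 0 ≤ w)
    {d : ℕ} (h : (fun n => (growthFunction S n : ℝ)) =O[atTop] fun n : ℕ => (n : ℝ) ^ d * w ^ n) :
    growthRate S ≤ w := by
  by_contra! hlt
  obtain ⟨w', hw', hlt'⟩ := exists_between hlt
  have hw0 : 0 < w' := hw.trans_lt hw'
  have hbig : (fun n : ℕ => w' ^ n) =O[atTop] fun n => (growthFunction S n : ℝ) :=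
    .of_bound' <| (eventually_pow_le_growthFunction hf hS hw0.le hlt').mono fun n hn => by
      rwa [Real.norm_of_nonneg (by positivity), Real.norm_of_nonneg (by positivity)]
  have hlittle : (fun n : ℕ => (n : ℝ) ^ d * w ^ n) =o[atTop] fun n => w' ^ n :=
    isLittleO_pow_const_mul_const_pow_const_pow_of_norm_lt d (by rwa [Real.norm_of_nonneg hw])
  exact Asymptotics.isLittleO_irrefl (.of_forall fun n => (pow_pos hw0 n).ne')
    ((hbig.trans h).trans_isLittleO hlittle)

end Growth

section Commute

variable {G ι : Type*} [Group G]

/-- The homomorphism from the free abelian group on `ι` that extends a family of pairwise commuting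
elements of a group. -/
noncomputable def homOfCommute (A : ι → G) (hA : ∀ i j, Commute (A i) (A j)) :
    Multiplicative (ι →₀ ℤ) →* G :=
  let H := Subgroup.closure (Set.range A)
  have : IsMulCommutative H := Subgroup.isMulCommutative_closure <| by
    rintro _ ⟨i, rfl⟩ _ ⟨j, rfl⟩
    exact hA i j
  let : CommGroup H := { mul_comm := mul_comm' }
  H.subtype.comp <| AddMonoidHom.toMultiplicativeLeft <| Finsupp.liftAddHom fun i =>
    zmultiplesHom (Additive H) (.ofMul ⟨A i, Subgroup.subset_closure ⟨i, rfl⟩⟩)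

lemma homOfCommute_single (A : ι → G) (hA : ∀ i j, Commute (A i) (A j)) (i : ι) :
    homOfCommute A hA (.ofAdd (Finsupp.single i 1)) = A i := by
  simp [homOfCommute]

lemma hom_ext_single_one {f g : Multiplicative (ι →₀ ℤ) →* G}
    (h : ∀ i, f (.ofAdd (Finsupp.single i 1)) = g (.ofAdd (Finsupp.single i 1))) : f = g :=
  Finsupp.mulHom_ext' fun i => MonoidHom.ext_mint (h i)

end Commute

namespace ZWrZ

/-- The coordinates of `g`, as a finitely supported function. -/
noncomputable def conf (g : ZWrZ) : ℤ →₀ ℤ :=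
  .ofSupportFinite (fun i => (g.1.left (.ofAdd i)).toAdd)
    (g.2.preimage (f := Multiplicative.ofAdd) Multiplicative.ofAdd.injective.injOn)

/-- The image of `g` in the acting group `ℤ`. -/
def pos (g : ZWrZ) : ℤ := g.1.right.toAdd

lemma ext_conf {g h : ZWrZ} (hconf : ∀ i, conf g i = conf h i) (hpos : pos g = pos h) : g = h :=
  Subtype.ext (RegularWreathProduct.ext (funext fun q => hconf q.toAdd) hpos)

@[simp] lemma conf_one : conf 1 = 0 := Finsupp.ext fun _ => rfl

@[simp] lemma pos_one : pos 1 = 0 := rfl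

lemma conf_mul_apply (g h : ZWrZ) (i : ℤ) : conf (g * h) i = conf g i + conf h (i - pos g) := by
  rw [sub_eq_neg_add]
  rfl

/-- The action of `n` on the base group, by shifting the coordinates. -/
noncomputable def shift (n : ℤ) : (ℤ →₀ ℤ) →+ (ℤ →₀ ℤ) :=
  (Finsupp.domCongr (Equiv.addRight n)).toAddMonoidHom

lemma shift_apply (n : ℤ) (F : ℤ →₀ ℤ) (i : ℤ) : shift n F i = F (i - n) := by
  simp [shift, sub_eq_add_neg]

lemma shift_single (n i x : ℤ) : shift n (Finsupp.single i x) = Finsupp.single (i + n) x := by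
  simp [shift]

lemma conf_mul (g h : ZWrZ) : conf (g * h) = conf g + shift (pos g) (conf h) := by
  ext i
  rw [conf_mul_apply, Finsupp.add_apply, shift_apply]

@[simp] lemma pos_mul (g h : ZWrZ) : pos (g * h) = pos g + pos h := rfl

lemma conf_inv_apply (g : ZWrZ) (i : ℤ) : conf g⁻¹ i = -conf g (i + pos g) := by
  rw [add_comm]
  rfl

@[simp] lemma pos_inv (g : ZWrZ) : pos g⁻¹ = -pos g := rfl

@[simp] lemma conf_a : conf a = Finsupp.single 0 1 := by
  ext i
  simp only [conf, a, Finsupp.ofSupportFinite_coe, Pi.mulSingle_apply, ofAdd_eq_one,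
    Finsupp.single_apply, eq_comm (a := i)]
  split_ifs <;> rfl

@[simp] lemma pos_a : pos a = 0 := rfl

@[simp] lemma conf_t : conf t = 0 := Finsupp.ext fun _ => rfl

@[simp] lemma pos_t : pos t = 1 := rfl

@[simp] lemma conf_t_zpow (n : ℤ) : conf (t ^ n) = 0 := by
  ext i
  induction n with
  | zero => simp
  | succ n ih => rw [zpow_add_one, conf_mul_apply, ih]; simp
  | pred n ih => rw [zpow_sub_one, conf_mul_apply, conf_inv_apply, ih]; simp

@[simp] lemma pos_t_zpow (n : ℤ) : pos (t ^ n) = n := by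
  induction n with
  | zero => simp
  | succ n ih => rw [zpow_add_one, pos_mul, ih, pos_t]
  | pred n ih => rw [zpow_sub_one, pos_mul, ih, pos_inv, pos_t, sub_eq_add_neg]

/-- The inclusion of the base group `⨁ ℤ`. -/
def base : Multiplicative (ℤ →₀ ℤ) →* ZWrZ where
  toFun F := ⟨⟨fun q => .ofAdd (F.toAdd q.toAdd), 1⟩,
    F.toAdd.hasFiniteSupport.preimage (f := Multiplicative.toAdd)
      Multiplicative.toAdd.injective.injOn⟩
  map_one' := rfl
  map_mul' F F' := ext_conf (fun i => by
    rw [conf_mul_apply]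
    change _ = F.toAdd i + F'.toAdd (i - 0)
    rw [sub_zero]
    rfl) rfl

@[simp] lemma conf_base (F : Multiplicative (ℤ →₀ ℤ)) : conf (base F) = F.toAdd :=
  Finsupp.ext fun _ => rfl

@[simp] lemma pos_base (F : Multiplicative (ℤ →₀ ℤ)) : pos (base F) = 0 := rfl

lemma base_single_one (i : ℤ) :
    base (.ofAdd (Finsupp.single i 1)) = t ^ i * a * (t ^ i)⁻¹ :=
  ext_conf (fun j => by simp [conf_mul_apply, conf_inv_apply, Finsupp.single_apply,
    eq_comm, sub_eq_zero]) (by simp)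

lemma eq_base_conf_mul_t_zpow (g : ZWrZ) : g = base (.ofAdd (conf g)) * t ^ pos g :=
  ext_conf (fun i => by simp [conf_mul_apply]) (by simp)

lemma base_mem_closure_a_t (F : ℤ →₀ ℤ) : base (.ofAdd F) ∈ Subgroup.closure {a, t} := by
  have ha : a ∈ Subgroup.closure {a, t} := Subgroup.subset_closure (by simp)
  have ht : t ∈ Subgroup.closure {a, t} := Subgroup.subset_closure (by simp)
  induction F using Finsupp.induction_linear with
  | zero => exact one_mem _
  | add F F' h h' => rw [ofAdd_add, map_mul]; exact mul_mem h h'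
  | single i n =>
    rw [← mul_one n, ← smul_eq_mul, ← Finsupp.smul_single, ofAdd_zsmul, map_zpow, base_single_one]
    exact zpow_mem (mul_mem (mul_mem (zpow_mem ht i) ha) (inv_mem (zpow_mem ht i))) n

theorem closure_a_t : Subgroup.closure ({a, t} : Set ZWrZ) = ⊤ := by
  refine (Subgroup.eq_top_iff' _).2 fun g => ?_
  rw [eq_base_conf_mul_t_zpow g]
  exact mul_mem (base_mem_closure_a_t _) (zpow_mem (Subgroup.subset_closure (by simp)) _)

/-- The homomorphism from the presented group to `ℤ ≀ ℤ` that sends the generators to `a` and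
`t`. -/
def ofPresented : PresentedGroup relators →* ZWrZ :=
  PresentedGroup.toGroup (f := ![a, t]) <| by
    rintro _ ⟨k, -, rfl⟩
    have ha : a = base (.ofAdd (Finsupp.single 0 1)) := by simp [base_single_one]
    have hconj : t ^ k * a * (t ^ k)⁻¹ = base (.ofAdd (Finsupp.single (k : ℤ) 1)) := by
      simp [base_single_one]
    simp only [map_commutatorElement, map_mul, map_pow, map_inv, FreeGroup.lift_apply_of,
      Matrix.cons_val_zero, Matrix.cons_val_one]
    rw [hconj, ha, commutatorElement_eq_one_iff_commute]
    exact (Commute.all _ _).map base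

@[simp] lemma ofPresented_zero : ofPresented (.of 0) = a := PresentedGroup.toGroup.of _

@[simp] lemma ofPresented_one : ofPresented (.of 1) = t := PresentedGroup.toGroup.of _

/-- The conjugate `t ^ i * a * t ^ (-i)` in the presented group. -/
def presentedConj (i : ℤ) : PresentedGroup relators := .of 1 ^ i * .of 0 * (.of 1 ^ i)⁻¹

lemma conj_presentedConj (n i : ℤ) :
    .of 1 ^ n * presentedConj i * (.of 1 ^ n)⁻¹ = presentedConj (i + n) := by
  simp only [presentedConj, add_comm i, zpow_add]
  group

lemma commute_presentedConj (i j : ℤ) : Commute (presentedConj i) (presentedConj j) := by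
  wlog h : j ≤ i generalizing i j
  · exact (this j i (by lia)).symm
  obtain ⟨k, rfl⟩ := Int.exists_add_of_le h
  have hk : Commute (presentedConj k) (presentedConj 0) := by
    rcases k.eq_zero_or_pos with rfl | hk
    · exact Commute.refl _
    · have hrel := PresentedGroup.one_of_mem (rels := relators) ⟨k, hk, rfl⟩
      rw [map_commutatorElement, commutatorElement_eq_one_iff_commute, map_mul, map_mul, map_inv,
        map_pow] at hrel
      have hzero : presentedConj 0 = .of 0 := by simp [presentedConj]
      rw [hzero, presentedConj, zpow_natCast]
      exact hrel
  have hconj := hk.map (MulAut.conj (.of 1 ^ j : PresentedGroup relators))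
  rwa [MulAut.conj_apply, MulAut.conj_apply, conj_presentedConj, conj_presentedConj, zero_add,
    add_comm _ j] at hconj

/-- The restriction to the base group of the inverse of `ofPresented`. -/
noncomputable def baseToPresented : Multiplicative (ℤ →₀ ℤ) →* PresentedGroup relators :=
  homOfCommute presentedConj commute_presentedConj

lemma baseToPresented_single_one (i : ℤ) :
    baseToPresented (.ofAdd (Finsupp.single i 1)) = presentedConj i :=
  homOfCommute_single _ _ i

lemma conj_baseToPresented (n : ℤ) (F : ℤ →₀ ℤ) :
    .of 1 ^ n * baseToPresented (.ofAdd F) * (.of 1 ^ n)⁻¹ =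
      baseToPresented (.ofAdd (shift n F)) := by
  have h : (MulAut.conj (.of 1 ^ n : PresentedGroup relators)).toMonoidHom.comp baseToPresented =
      baseToPresented.comp (AddMonoidHom.toMultiplicative (shift n)) :=
    hom_ext_single_one fun i => by
      change .of 1 ^ n * baseToPresented _ * (.of 1 ^ n)⁻¹ =
        baseToPresented (.ofAdd (shift n (Finsupp.single i 1)))
      rw [shift_single, baseToPresented_single_one, baseToPresented_single_one, conj_presentedConj]
  have hF := DFunLike.congr_fun h (.ofAdd F)
  rw [MonoidHom.comp_apply, MonoidHom.comp_apply] at hF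
  exact hF

/-- The inverse of `ofPresented`. -/
noncomputable def toPresented : ZWrZ →* PresentedGroup relators where
  toFun g := baseToPresented (.ofAdd (conf g)) * .of 1 ^ pos g
  map_one' := by simp
  map_mul' g h := by
    rw [conf_mul, ofAdd_add, map_mul, ← conj_baseToPresented, pos_mul, zpow_add]
    group

@[simp] lemma toPresented_a : toPresented a = .of 0 := by
  change baseToPresented (.ofAdd (conf a)) * .of 1 ^ pos a = _
  rw [conf_a, baseToPresented_single_one]
  simp [presentedConj]

@[simp] lemma toPresented_t : toPresented t = .of 1 := by
  change baseToPresented (.ofAdd (conf t)) * .of 1 ^ pos t = _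
  simp

/-- The presentation `⟨a, t ∣ [t ^ k * a * t ^ (-k), a] = 1 (k = 1, 2, …)⟩` of `ℤ ≀ ℤ`. -/
noncomputable def presentedEquiv : PresentedGroup relators ≃* ZWrZ :=
  ofPresented.toMulEquiv toPresented
    (PresentedGroup.ext fun i => by fin_cases i <;> simp)
    (MonoidHom.eq_of_eqOn_dense closure_a_t <| by rintro _ (rfl | rfl) <;> simp)

end ZWrZ

lemma sum_Icc_pow_natAbs_le {z : ℝ} (hz : 0 ≤ z) (hz1 : z < 1) (M : ℕ) :
    ∑ j ∈ Finset.Icc (-(M : ℤ)) M, z ^ j.natAbs ≤ (1 + z) / (1 - z) := by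
  suffices h : (1 - z) * ∑ j ∈ Finset.Icc (-(M : ℤ)) M, z ^ j.natAbs = 1 + z - 2 * z ^ (M + 1) by
    rw [le_div_iff₀' (by linarith), h]
    linarith [pow_nonneg hz (M + 1)]
  induction M with
  | zero => simp; ring
  | succ M ih =>
    have e : Finset.Icc (-((M + 1 : ℕ) : ℤ)) (M + 1 : ℕ) =
        insert (-((M + 1 : ℕ) : ℤ)) (insert ((M + 1 : ℕ) : ℤ) (Finset.Icc (-(M : ℤ)) M)) := by
      ext i
      simp only [Finset.mem_Icc, Finset.mem_insert]
      lia
    rw [e, Finset.sum_insert (by simp only [Finset.mem_insert, Finset.mem_Icc]; lia),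
      Finset.sum_insert (by simp), mul_add, mul_add, ih, Int.natAbs_neg, Int.natAbs_natCast]
    ring

section IntegerPoints

variable {ι : Type*} [Fintype ι]

lemma setOf_sum_natAbs_le_subset (M : ℕ) :
    {f : ι → ℤ | ∑ i, (f i).natAbs ≤ M} ⊆ Set.univ.pi fun _ => Set.Icc (-(M : ℤ)) M := by
  intro f hf i _
  have := (Finset.single_le_sum (f := fun i => (f i).natAbs) (fun _ _ => Nat.zero_le _)
    (Finset.mem_univ i)).trans hf
  rw [Set.mem_Icc]
  lia

lemma finite_setOf_sum_natAbs_le (M : ℕ) : {f : ι → ℤ | ∑ i, (f i).natAbs ≤ M}.Finite :=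
  (Set.Finite.pi' fun _ => Set.finite_Icc _ _).subset fun _ hf i =>
    setOf_sum_natAbs_le_subset M hf i trivial

-- The generating function of the `ℓ¹` norm on `ι → ℤ` is the power of the one on `ℤ`.
lemma ncard_sum_natAbs_le {z : ℝ} (hz : 0 < z) (hz1 : z < 1) (M : ℕ) :
    ({f : ι → ℤ | ∑ i, (f i).natAbs ≤ M}.ncard : ℝ) * z ^ M ≤
      ((1 + z) / (1 - z)) ^ Fintype.card ι := by
  classical
  have hfin := finite_setOf_sum_natAbs_le (ι := ι) M
  rw [Set.ncard_eq_toFinset_card _ hfin, ← nsmul_eq_mul, ← Finset.sum_const]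
  calc ∑ _f ∈ hfin.toFinset, z ^ M ≤ ∑ f ∈ hfin.toFinset, ∏ i, z ^ (f i).natAbs := by
        refine Finset.sum_le_sum fun f hf => ?_
        rw [Finset.prod_pow_eq_pow_sum]
        exact pow_le_pow_of_le_one hz.le hz1.le (hfin.mem_toFinset.1 hf)
    _ ≤ ∑ f ∈ Fintype.piFinset fun _ : ι => Finset.Icc (-(M : ℤ)) M, ∏ i, z ^ (f i).natAbs :=
        Finset.sum_le_sum_of_subset_of_nonneg
          (fun f hf => Fintype.mem_piFinset.2 fun i => Finset.mem_Icc.2 <|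
            setOf_sum_natAbs_le_subset M (hfin.mem_toFinset.1 hf) i trivial)
          fun f _ _ => Finset.prod_nonneg fun i _ => by positivity
    _ = ∏ _i : ι, ∑ j ∈ Finset.Icc (-(M : ℤ)) M, z ^ j.natAbs := by
        rw [Finset.prod_univ_sum]
    _ ≤ ∏ _i : ι, (1 + z) / (1 - z) :=
        Finset.prod_le_prod (fun i _ => Finset.sum_nonneg fun _ _ => by positivity)
          fun i _ => sum_Icc_pow_natAbs_le hz.le hz1 M
    _ = _ := by rw [Finset.prod_const, Finset.card_univ]

lemma sqrt_two_bounds : 1 < √2 ∧ √2 < 3 / 2 := by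
  constructor
  · rw [Real.lt_sqrt] <;> norm_num
  · rw [Real.sqrt_lt'] <;> norm_num

-- `z = √2 - 1` is the positive solution of `(1 + z) / (1 - z) = z⁻¹`.
lemma ncard_sum_natAbs_le_one_add_sqrt_two_pow (ι : Type*) [Fintype ι] (M : ℕ) :
    ({f : ι → ℤ | ∑ i, (f i).natAbs ≤ M}.ncard : ℝ) ≤ (1 + √2) ^ (Fintype.card ι + M) := by
  obtain ⟨hlow, hhigh⟩ := sqrt_two_bounds
  have hsq : √2 * √2 = 2 := by norm_num
  have hcard := ncard_sum_natAbs_le (ι := ι) (z := √2 - 1) (by linarith) (by linarith) M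
  have hratio : (1 + (√2 - 1)) / (1 - (√2 - 1)) = 1 + √2 := by
    rw [div_eq_iff (by linarith)]
    linarith
  have hinv : (√2 - 1) * (1 + √2) = 1 := by linarith
  rw [hratio] at hcard
  calc _ = {f : ι → ℤ | ∑ i, (f i).natAbs ≤ M}.ncard * (√2 - 1) ^ M * (1 + √2) ^ M := by
        rw [mul_assoc, ← mul_pow, hinv, one_pow, mul_one]
    _ ≤ (1 + √2) ^ Fintype.card ι * (1 + √2) ^ M := by gcongr
    _ = _ := (pow_add _ _ _).symm

end IntegerPoints

/-- The `ℓ¹` norm of a finitely supported integer vector. -/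
def l1Norm {ι : Type*} (F : ι →₀ ℤ) : ℕ := F.sum fun _ x => x.natAbs

lemma l1Norm_eq_sum {ι : Type*} {F : ι →₀ ℤ} {s : Finset ι} (hs : F.support ⊆ s) :
    l1Norm F = ∑ i ∈ s, (F i).natAbs :=
  Finsupp.sum_of_support_subset F hs _ fun _ _ => Int.natAbs_zero

lemma l1Norm_add_le {ι : Type*} (F F' : ι →₀ ℤ) : l1Norm (F + F') ≤ l1Norm F + l1Norm F' := by
  classical
  rw [l1Norm_eq_sum Finsupp.support_add, l1Norm_eq_sum Finset.subset_union_left,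
    l1Norm_eq_sum Finset.subset_union_right, ← Finset.sum_add_distrib]
  exact Finset.sum_le_sum fun i _ => Int.natAbs_add_le _ _

lemma l1Norm_single {ι : Type*} (i : ι) (x : ℤ) : l1Norm (Finsupp.single i x) = x.natAbs :=
  Finsupp.sum_single_index Int.natAbs_zero

namespace ZWrZ

/-- The elements over `n ∈ [-p, q]` with coordinates supported in `[-p, q]` whose `ℓ¹` norm and the
length `2 * p + 2 * q - |n|` of the shortest tour from `0` to `n` through `-p` and `q` add up to at
most `N`. -/
def tourBall (p q : ℕ) (n : ℤ) (N : ℕ) : Set ZWrZ :=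
  {g | (conf g).support ⊆ Finset.Icc (-(p : ℤ)) q ∧ pos g = n ∧ n ∈ Finset.Icc (-(p : ℤ)) q ∧
    l1Norm (conf g) + (2 * p + 2 * q) ≤ N + n.natAbs}

variable {p q N : ℕ} {n : ℤ} {g s : ZWrZ}

lemma mul_mem_tourBall_of_conf_eq_single (hg : g ∈ tourBall p q n N) {e : ℤ} (he : e.natAbs = 1)
    (hconf : conf s = Finsupp.single 0 e) (hpos : pos s = 0) :
    g * s ∈ tourBall p q n (N + 1) := by
  obtain ⟨hsupp, rfl, hmem, hN⟩ := hg
  have hgs : conf (g * s) = conf g + Finsupp.single (pos g) e := by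
    rw [conf_mul, hconf, shift_single, zero_add]
  refine ⟨?_, by simp [hpos], hmem, ?_⟩
  · rw [hgs]
    exact Finsupp.support_add.trans <| Finset.union_subset hsupp <|
      Finsupp.support_single_subset.trans (Finset.singleton_subset_iff.2 hmem)
  · have hle := l1Norm_add_le (conf g) (Finsupp.single (pos g) e)
    rw [l1Norm_single, he, ← hgs] at hle
    lia

lemma exists_mul_mem_tourBall_of_conf_eq_zero (hg : g ∈ tourBall p q n N) (hconf : conf s = 0)
    (hpos : (pos s).natAbs = 1) : ∃ p' q', g * s ∈ tourBall p' q' (n + pos s) (N + 1) := by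
  obtain ⟨hsupp, rfl, hmem, hN⟩ := hg
  rw [Finset.mem_Icc] at hmem
  have hgs : conf (g * s) = conf g := by rw [conf_mul, hconf, map_zero, add_zero]
  have henlarge (p' q' : ℕ) (hp : p ≤ p') (hq : q ≤ q')
      (hmem' : pos g + pos s ∈ Finset.Icc (-(p' : ℤ)) q')
      (hlen : 2 * p' + 2 * q' + (pos g).natAbs ≤ 2 * p + 2 * q + 1 + (pos g + pos s).natAbs) :
      ∃ p' q', g * s ∈ tourBall p' q' (pos g + pos s) (N + 1) := by
    refine ⟨p', q', ?_, pos_mul g s, hmem', ?_⟩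
    · rw [hgs]
      exact hsupp.trans (Finset.Icc_subset_Icc (by lia) (by lia))
    · rw [hgs]
      lia
  simp only [Finset.mem_Icc] at henlarge
  by_cases hleft : pos g + pos s < -p
  · exact henlarge (p + 1) q (by lia) le_rfl (by lia) (by lia)
  by_cases hright : (q : ℤ) < pos g + pos s
  · exact henlarge p (q + 1) le_rfl (by lia) (by lia) (by lia)
  · exact henlarge p q le_rfl le_rfl (by lia) (by lia)

lemma exists_prod_mem_tourBall {l : List ZWrZ}
    (hl : ∀ x ∈ l, x ∈ ({a, t} : Set ZWrZ) ∨ x⁻¹ ∈ ({a, t} : Set ZWrZ)) :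
    ∃ p q n, l.prod ∈ tourBall p q n l.length := by
  induction l using List.reverseRecOn with
  | nil => exact ⟨0, 0, 0, by simp [tourBall, l1Norm]⟩
  | append_singleton l s ih =>
    obtain ⟨p, q, n, hg⟩ := ih fun x hx => hl x (by simp [hx])
    rw [List.prod_append, List.prod_singleton, List.length_append, List.length_singleton]
    have hconf_inv (x : ZWrZ) (hx : pos x = 0) : conf x⁻¹ = -conf x := by
      ext i
      simp [conf_inv_apply, hx]
    rcases hl s (by simp) with (rfl | rfl) | (hs | hs)
    · exact ⟨p, q, n, mul_mem_tourBall_of_conf_eq_single hg rfl conf_a pos_a⟩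
    · obtain ⟨p', q', h⟩ := exists_mul_mem_tourBall_of_conf_eq_zero hg conf_t rfl
      exact ⟨p', q', _, h⟩
    · obtain rfl := inv_eq_iff_eq_inv.1 hs
      exact ⟨p, q, n, mul_mem_tourBall_of_conf_eq_single (e := -1) hg rfl
        (by rw [hconf_inv a rfl, conf_a, Finsupp.single_neg]) rfl⟩
    · obtain rfl := inv_eq_iff_eq_inv.1 hs
      obtain ⟨p', q', h⟩ := exists_mul_mem_tourBall_of_conf_eq_zero (s := t⁻¹) hg
        (by ext i; simp [conf_inv_apply]) rfl
      exact ⟨p', q', _, h⟩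

lemma injOn_conf_tourBall :
    Set.InjOn (fun g (i : Finset.Icc (-(p : ℤ)) q) => conf g i) (tourBall p q n N) := by
  rintro g ⟨hg, hgn, -⟩ g' ⟨hg', hgn', -⟩ h
  refine ext_conf (fun i => ?_) (hgn.trans hgn'.symm)
  by_cases hi : i ∈ Finset.Icc (-(p : ℤ)) q
  · exact congrFun h ⟨i, hi⟩
  · rw [Finsupp.notMem_support_iff.1 fun h => hi (hg h),
      Finsupp.notMem_support_iff.1 fun h => hi (hg' h)]

lemma mapsTo_conf_tourBall {M : ℕ} (hM : N + n.natAbs ≤ 2 * p + 2 * q + M) :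
    Set.MapsTo (fun g (i : Finset.Icc (-(p : ℤ)) q) => conf g i) (tourBall p q n N)
      {f | ∑ i, (f i).natAbs ≤ M} := by
  rintro g ⟨hg, -, -, hN⟩
  rw [l1Norm_eq_sum hg, ← Finset.sum_coe_sort] at hN
  simp only [Set.mem_ofPred_eq]
  lia

lemma finite_tourBall : (tourBall p q n N).Finite :=
  .of_finite_image ((finite_setOf_sum_natAbs_le (N + n.natAbs)).subset
    (mapsTo_conf_tourBall (by lia)).image_subset) injOn_conf_tourBall

lemma ncard_tourBall_le : ((tourBall p q n N).ncard : ℝ) ≤ (1 + √2) ^ (N + 1) := by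
  rcases (tourBall p q n N).eq_empty_or_nonempty with hempty | ⟨g, -, -, hn, hN⟩
  · rw [hempty, Set.ncard_empty, Nat.cast_zero]
    positivity
  rw [Finset.mem_Icc] at hn
  obtain ⟨M, hM⟩ : ∃ M, N + n.natAbs = 2 * p + 2 * q + M := ⟨N + n.natAbs - (2 * p + 2 * q), by lia⟩
  have hcard : Fintype.card (Finset.Icc (-(p : ℤ)) q) = p + q + 1 := by
    rw [Fintype.card_coe, Int.card_Icc]
    lia
  calc ((tourBall p q n N).ncard : ℝ)
      ≤ {f : Finset.Icc (-(p : ℤ)) q → ℤ | ∑ i, (f i).natAbs ≤ M}.ncard := by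
        exact_mod_cast Set.ncard_le_ncard_of_injOn _ (mapsTo_conf_tourBall hM.le)
          injOn_conf_tourBall (finite_setOf_sum_natAbs_le M)
    _ ≤ (1 + √2) ^ (p + q + 1 + M) := hcard ▸ ncard_sum_natAbs_le_one_add_sqrt_two_pow _ M
    _ ≤ (1 + √2) ^ (N + 1) :=
        pow_le_pow_right₀ (le_add_of_nonneg_right (Real.sqrt_nonneg 2)) (by lia)

/-- The triples `(p, q, n)` for which `tourBall p q n N` can be nonempty. -/
noncomputable def tourIndex (N : ℕ) : Finset (ℕ × ℕ × ℤ) :=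
  Finset.range (N + 1) ×ˢ Finset.range (N + 1) ×ˢ Finset.Icc (-(N : ℤ)) N

lemma card_tourIndex_le (N : ℕ) : (tourIndex N).card ≤ 2 * (N + 1) ^ 3 := by
  have hcard : (tourIndex N).card = (N + 1) * ((N + 1) * (2 * N + 1)) := by
    simp only [tourIndex, Finset.card_product, Finset.card_range, Int.card_Icc]
    congr 2
    lia
  rw [hcard]
  nlinarith

lemma ball_a_t_subset (N : ℕ) :
    {g : ZWrZ | wordLength {a, t} g ≤ N} ⊆ ⋃ x ∈ tourIndex N, tourBall x.1 x.2.1 x.2.2 N := by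
  intro g hg
  obtain ⟨l, hl, rfl, hlen⟩ := exists_word closure_a_t g
  obtain ⟨p, q, n, hsupp, hpos, hn, hN⟩ := exists_prod_mem_tourBall hl
  rw [Set.mem_ofPred_eq, ← hlen] at hg
  refine Set.mem_biUnion (x := (p, q, n)) ?_ ⟨hsupp, hpos, hn, by lia⟩
  simp only [tourIndex, SetLike.mem_coe, Finset.mem_product, Finset.mem_range, Finset.mem_Icc]
    at hn ⊢
  lia

lemma growthFunction_a_t_le (N : ℕ) :
    (growthFunction ({a, t} : Set ZWrZ) N : ℝ) ≤ 2 * (N + 1) ^ 3 * (1 + √2) ^ (N + 1) := by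
  calc (growthFunction {a, t} N : ℝ)
      ≤ ∑ x ∈ tourIndex N, ((tourBall x.1 x.2.1 x.2.2 N).ncard : ℝ) := by
        exact_mod_cast (Set.ncard_le_ncard (ball_a_t_subset N)
          ((tourIndex N).finite_toSet.biUnion fun _ _ => finite_tourBall)).trans
          (Finset.set_ncard_biUnion_le _ _)
    _ ≤ (tourIndex N).card • (1 + √2) ^ (N + 1) :=
        Finset.sum_le_card_nsmul _ _ _ fun _ _ => ncard_tourBall_le
    _ ≤ 2 * (N + 1) ^ 3 * (1 + √2) ^ (N + 1) := by
        rw [nsmul_eq_mul]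
        gcongr
        exact_mod_cast card_tourIndex_le N

theorem growthRate_a_t_le : growthRate ({a, t} : Set ZWrZ) ≤ 1 + √2 := by
  refine growthRate_le_of_isBigO (by simp) closure_a_t (by positivity) (d := 3) <|
    .of_bound (16 * (1 + √2)) <| (eventually_ge_atTop 1).mono fun N hN => ?_
  rw [Real.norm_of_nonneg (by positivity), Real.norm_of_nonneg (by positivity)]
  have hN' : (N + 1 : ℝ) ≤ 2 * N := by
    have : (1 : ℝ) ≤ N := by exact_mod_cast hN
    linarith
  calc (growthFunction {a, t} N : ℝ) ≤ 2 * (N + 1) ^ 3 * (1 + √2) ^ (N + 1) :=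
        growthFunction_a_t_le N
    _ ≤ 2 * (2 * N) ^ 3 * (1 + √2) ^ (N + 1) := by gcongr
    _ = 16 * (1 + √2) * (N ^ 3 * (1 + √2) ^ N) := by ring

end ZWrZ

section AlmostInvariant

open MeasureTheory

variable {α : Type*} [MeasurableSpace α] {μ : Measure α} {f g : Equiv.Perm α} {c d : ℝ}

/-- The permutation `f` and its inverse shrink the `μ`-measure of every set by at most the
factor `c`. -/
def AlmostInvariant (μ : Measure α) (c : ℝ) (f : Equiv.Perm α) : Prop :=
  ∀ s, c * μ.real (f ⁻¹' s) ≤ μ.real s ∧ c * μ.real s ≤ μ.real (f ⁻¹' s)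

namespace AlmostInvariant

lemma inv (hf : AlmostInvariant μ c f) : AlmostInvariant μ c f⁻¹ := fun s => by
  have h := hf (⇑f⁻¹ ⁻¹' s)
  rw [← Set.preimage_comp, ← Equiv.Perm.coe_mul, inv_mul_cancel, Equiv.Perm.coe_one,
    Set.preimage_id] at h
  exact h.symm

lemma mul (hf : AlmostInvariant μ c f) (hg : AlmostInvariant μ d g) (hc : 0 ≤ c) (hd : 0 ≤ d) :
    AlmostInvariant μ (c * d) (f * g) := fun s => by
  rw [Equiv.Perm.coe_mul, Set.preimage_comp]
  constructor
  · rw [mul_assoc]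
    exact (mul_le_mul_of_nonneg_left (hg _).1 hc).trans (hf s).1
  · rw [mul_comm c, mul_assoc]
    exact (mul_le_mul_of_nonneg_left (hf s).2 hd).trans (hg _).2

variable [DiscreteMeasurableSpace α] [IsFiniteMeasure μ]

lemma measureReal_preimage_sdiff_le (hf : AlmostInvariant μ c f) {s : Set α} (hs : s ⊆ f ⁻¹' s) :
    μ.real (f ⁻¹' s \ s) ≤ (1 - c) * μ.real (f ⁻¹' s) := by
  rw [measureReal_sdiff hs (.of_discrete), sub_mul, one_mul]
  exact sub_le_sub_left (hf s).1 _

lemma measureReal_sdiff_preimage_le (hf : AlmostInvariant μ c f) {s : Set α} (hs : f ⁻¹' s ⊆ s) :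
    μ.real (s \ f ⁻¹' s) ≤ (1 - c) * μ.real s := by
  rw [measureReal_sdiff hs (.of_discrete), sub_mul, one_mul]
  exact sub_le_sub_left (hf s).2 _

end AlmostInvariant

variable {G : Type*} [Group G] {S : Set G} {z : ℝ}

/-- The image under the orbit map of `x` of the measure on `G` of density `g ↦ z ^ ℓ(g)`, where `ℓ`
is the word length. -/
noncomputable def orbitMeasure (S : Set G) (z : ℝ) (ρ : G →* Equiv.Perm α) (x : α) : Measure α :=
  .sum fun g => ENNReal.ofReal (z ^ wordLength S g) • .dirac (ρ g x)

variable [DiscreteMeasurableSpace α] (ρ : G →* Equiv.Perm α) (x : α)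

lemma orbitMeasure_apply (E : Set α) : orbitMeasure S z ρ x E =
    ∑' g, ENNReal.ofReal (z ^ wordLength S g) * E.indicator 1 (ρ g x) := by
  simp [orbitMeasure, Measure.sum_apply _ (.of_discrete : MeasurableSet E)]

lemma isFiniteMeasure_orbitMeasure (hf : S.Finite) (hS : Subgroup.closure S = ⊤) (hz : 0 < z)
    (h : growthRate S < z⁻¹) : IsFiniteMeasure (orbitMeasure S z ρ x) := by
  constructor
  rw [orbitMeasure_apply]
  simpa using (summable_pow_wordLength hf hS hz h).tsum_ofReal_lt_top

lemma ofReal_mul_orbitMeasure_preimage_le (hS : Subgroup.closure S = ⊤) (hz : 0 ≤ z) (hz1 : z ≤ 1)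
    {s : G} (hs : s ∈ S ∨ s⁻¹ ∈ S) (E : Set α) :
    ENNReal.ofReal z * orbitMeasure S z ρ x (ρ s ⁻¹' E) ≤ orbitMeasure S z ρ x E := by
  rw [orbitMeasure_apply, orbitMeasure_apply, ← ENNReal.tsum_mul_left,
    ← (Equiv.mulLeft s).tsum_eq fun g => ENNReal.ofReal (z ^ wordLength S g) * _]
  refine ENNReal.tsum_le_tsum fun g => ?_
  have hle : z * z ^ wordLength S g ≤ z ^ wordLength S (s * g) := by
    rw [← pow_succ']
    exact pow_le_pow_of_le_one hz hz1 (wordLength_mul_le_add_one hS hs g)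
  rw [← mul_assoc, ← ENNReal.ofReal_mul hz, Equiv.coe_mulLeft, map_mul]
  exact mul_le_mul_left (ENNReal.ofReal_le_ofReal hle) _

lemma almostInvariant_orbitMeasure (hf : S.Finite) (hS : Subgroup.closure S = ⊤) (hz : 0 < z)
    (hz1 : z ≤ 1) (h : growthRate S < z⁻¹) {s : G} (hs : s ∈ S ∨ s⁻¹ ∈ S) :
    AlmostInvariant (orbitMeasure S z ρ x) z (ρ s) := by
  have := isFiniteMeasure_orbitMeasure ρ x hf hS hz h
  have hle {s : G} (hs : s ∈ S ∨ s⁻¹ ∈ S) (E : Set α) :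
      z * (orbitMeasure S z ρ x).real (ρ s ⁻¹' E) ≤ (orbitMeasure S z ρ x).real E := by
    have := ENNReal.toReal_mono (measure_ne_top _ _)
      (ofReal_mul_orbitMeasure_preimage_le ρ x hS hz.le hz1 hs E)
    rwa [ENNReal.toReal_mul, ENNReal.toReal_ofReal hz.le] at this
  refine fun E => ⟨hle hs E, ?_⟩
  have := hle (s := s⁻¹) (by rwa [inv_inv, or_comm]) (ρ s ⁻¹' E)
  rwa [← Set.preimage_comp, ← Equiv.Perm.coe_mul, ← map_mul, mul_inv_cancel, map_one] at this

lemma measureReal_orbitMeasure_ne_zero (hf : S.Finite) (hS : Subgroup.closure S = ⊤) (hz : 0 < z)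
    (h : growthRate S < z⁻¹) {E : Set α} (hx : x ∈ E) : (orbitMeasure S z ρ x).real E ≠ 0 := by
  have := isFiniteMeasure_orbitMeasure ρ x hf hS hz h
  rw [measureReal_ne_zero_iff, orbitMeasure_apply]
  refine ((ENNReal.le_tsum 1).trans_lt' ?_).ne'
  simp [hx, hz]

end AlmostInvariant

section Affine

open MeasureTheory
open scoped LaurentSeries

variable {R : Type*} [CommRing R] {n m i l : ℤ} {b c p q : R⸨X⸩} {C : ℝ}

/-- The set of the Laurent series that agree with `c` in degrees less than `n`. -/
def laurentBall (c : R⸨X⸩) (n : ℤ) : Set R⸨X⸩ := {y | ∀ i < n, y.coeff i = c.coeff i}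

/-- The permutation `y ↦ X ^ n * y + b` of the ring of Laurent series. -/
noncomputable def affinePerm (n : ℤ) (b : R⸨X⸩) : Equiv.Perm R⸨X⸩ where
  toFun y := .single n 1 * y + b
  invFun y := .single (-n) 1 * (y - b)
  left_inv y := by simp [← mul_assoc]
  right_inv y := by simp [← mul_assoc]

lemma affinePerm_apply (n : ℤ) (b y : R⸨X⸩) : affinePerm n b y = .single n 1 * y + b := rfl

lemma coeff_affinePerm (n : ℤ) (b y : R⸨X⸩) (i : ℤ) :
    (affinePerm n b y).coeff i = y.coeff (i - n) + b.coeff i := by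
  rw [affinePerm_apply, HahnSeries.coeff_add, HahnSeries.coeff_single_mul, one_mul]

lemma affinePerm_mul (n m : ℤ) (b c : R⸨X⸩) :
    affinePerm n b * affinePerm m c = affinePerm (n + m) (.single n 1 * c + b) := by
  ext1 y
  rw [Equiv.Perm.mul_apply, affinePerm_apply, affinePerm_apply, affinePerm_apply, mul_add,
    ← mul_assoc, HahnSeries.single_mul_single, one_mul, add_assoc]

lemma affinePerm_zero_zero : affinePerm 0 (0 : R⸨X⸩) = 1 := by
  ext1 y
  simp [affinePerm_apply]

lemma affinePerm_inv (n : ℤ) (b : R⸨X⸩) :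
    (affinePerm n b)⁻¹ = affinePerm (-n) (-(.single (-n) 1 * b)) := by
  rw [inv_eq_iff_mul_eq_one, affinePerm_mul, mul_neg, ← mul_assoc]
  simp [affinePerm_zero_zero]

lemma laurentBall_anti (c : R⸨X⸩) : Antitone (laurentBall c) :=
  fun _ _ h _ hy i hi => hy i (hi.trans_le h)

lemma laurentBall_one_zero : laurentBall (1 : R⸨X⸩) 0 = laurentBall 0 0 := by
  ext y
  exact forall₂_congr fun i hi => by rw [HahnSeries.coeff_one, if_neg hi.ne, HahnSeries.coeff_zero]

lemma one_sub_single_mem_laurentBall (hn : 0 < n) :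
    (1 - .single n 1 : R⸨X⸩) ∈ laurentBall 1 1 := fun i hi => by
  rw [HahnSeries.coeff_sub, HahnSeries.coeff_single_of_ne (by lia), sub_zero]

lemma affinePerm_preimage_laurentBall (n : ℤ) (b p : R⸨X⸩) (i : ℤ) :
    affinePerm n b ⁻¹' laurentBall (affinePerm n b p) (i + n) = laurentBall p i := by
  ext y
  simp only [laurentBall, Set.mem_preimage, Set.mem_ofPred_eq, coeff_affinePerm, add_left_inj]
  exact ⟨fun h j hj => by simpa using h (j + n) (by lia), fun h j hj => h (j - n) (by lia)⟩

lemma affinePerm_zero_preimage_sep {θ : R⸨X⸩} (hθ : θ ∈ laurentBall 1 1) (P : R → Prop) :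
    affinePerm 0 θ ⁻¹' {y ∈ laurentBall 0 0 | P (y.coeff 0)} =
      {y ∈ laurentBall 0 0 | P (y.coeff 0 + 1)} := by
  ext y
  simp only [laurentBall, Set.mem_preimage, Set.mem_ofPred_eq, coeff_affinePerm, sub_zero,
    hθ 0 one_pos, HahnSeries.coeff_one, if_true]
  exact and_congr_left' <| forall₂_congr fun i hi => by
    rw [hθ i (hi.trans one_pos), HahnSeries.coeff_one, if_neg hi.ne, add_zero]

variable [MeasurableSpace R⸨X⸩] {μ : Measure R⸨X⸩}

namespace AlmostInvariant

lemma mul_measureReal_laurentBall_le (h : AlmostInvariant μ C (affinePerm n b))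
    (hpq : affinePerm n b p = q) :
    C * μ.real (laurentBall p i) ≤ μ.real (laurentBall q (i + n)) := by
  rw [← hpq, ← affinePerm_preimage_laurentBall n b p i]
  exact (h _).1

variable [DiscreteMeasurableSpace R⸨X⸩] [IsFiniteMeasure μ]

lemma mul_measureReal_laurentBall_sub_le (h : AlmostInvariant μ C (affinePerm n b))
    (hpq : affinePerm n b p = q) (hil : i ≤ l) :
    C * (μ.real (laurentBall p i) - μ.real (laurentBall p l)) ≤
      μ.real (laurentBall q (i + n)) - μ.real (laurentBall q (l + n)) := by
  subst hpq
  have := (h (laurentBall (affinePerm n b p) (i + n) \ laurentBall (affinePerm n b p) (l + n))).1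
  rwa [Set.preimage_sdiff, affinePerm_preimage_laurentBall, affinePerm_preimage_laurentBall,
    measureReal_sdiff (laurentBall_anti _ hil) .of_discrete,
    measureReal_sdiff (laurentBall_anti _ (by lia)) .of_discrete] at this

variable [LinearOrder R] [IsStrictOrderedRing R]

lemma measureReal_laurentBall_one_le {θ : R⸨X⸩} (h : AlmostInvariant μ C (affinePerm 0 θ))
    (hθ : θ ∈ laurentBall 1 1) : μ.real (laurentBall 1 1) ≤
      (1 - C) * μ.real {y : R⸨X⸩ | y ∈ laurentBall 0 0 ∧ 1 ≤ y.coeff 0} := by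
  have hpre : affinePerm 0 θ ⁻¹' {y ∈ laurentBall 0 0 | 2 ≤ y.coeff 0} =
      {y ∈ laurentBall 0 0 | 1 ≤ y.coeff 0} := by
    rw [affinePerm_zero_preimage_sep hθ (2 ≤ ·)]
    simp only [← one_add_one_eq_two, add_le_add_iff_right]
  rw [← hpre]
  refine (measureReal_mono fun y hy => ?_).trans <| h.measureReal_preimage_sdiff_le ?_
  · have hy0 : y.coeff 0 = 1 := by simpa using hy 0 one_pos
    rw [hpre]
    refine ⟨⟨?_, hy0.ge⟩, fun h2 => one_lt_two.not_ge (hy0 ▸ h2.2)⟩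
    rw [← laurentBall_one_zero]
    exact laurentBall_anti 1 zero_le_one hy
  · rw [hpre]
    exact fun y hy => ⟨hy.1, one_le_two.trans hy.2⟩

lemma measureReal_laurentBall_zero_le {θ : R⸨X⸩} (h : AlmostInvariant μ C (affinePerm 0 θ))
    (hθ : θ ∈ laurentBall 1 1) : μ.real (laurentBall 0 1) ≤
      (1 - C) * μ.real {y : R⸨X⸩ | y ∈ laurentBall 0 0 ∧ y.coeff 0 < 1} := by
  have hpre : affinePerm 0 θ ⁻¹' {y ∈ laurentBall 0 0 | y.coeff 0 < 1} =
      {y ∈ laurentBall 0 0 | y.coeff 0 < 0} := by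
    rw [affinePerm_zero_preimage_sep hθ (· < 1)]
    simp only [add_lt_iff_neg_right]
  refine (measureReal_mono fun y hy => ?_).trans <| h.measureReal_sdiff_preimage_le ?_
  · have hy0 : y.coeff 0 = 0 := by simpa using hy 0 one_pos
    rw [hpre]
    exact ⟨⟨laurentBall_anti 0 zero_le_one hy, hy0.trans_lt one_pos⟩, fun h0 => h0.2.ne hy0⟩
  · rw [hpre]
    exact fun y hy => ⟨hy.1, hy.2.trans one_pos⟩

-- Cut the ball into the half-balls `1 ≤ y.coeff 0` and `y.coeff 0 < 1`: the translation shrinks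
-- the first by the slab `y.coeff 0 = 1`, and its inverse the second by the slab `y.coeff 0 = 0`.
theorem measureReal_laurentBall_one_add_zero_le {θ : R⸨X⸩}
    (h : AlmostInvariant μ C (affinePerm 0 θ)) (hθ : θ ∈ laurentBall 1 1) :
    μ.real (laurentBall 1 1) + μ.real (laurentBall 0 1) ≤ (1 - C) * μ.real (laurentBall 0 0) := by
  have hsplit : μ.real (laurentBall (0 : R⸨X⸩) 0) =
      μ.real {y : R⸨X⸩ | y ∈ laurentBall 0 0 ∧ 1 ≤ y.coeff 0} +
        μ.real {y : R⸨X⸩ | y ∈ laurentBall 0 0 ∧ y.coeff 0 < 1} := by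
    rw [← measureReal_union _ .of_discrete]
    · congr 1
      ext y
      simp only [Set.mem_union, Set.mem_ofPred_eq, ← and_or_left, le_or_gt, and_true]
    · exact Set.disjoint_left.2 fun y hy hy' => hy.2.not_gt hy'.2
  rw [hsplit, mul_add]
  exact add_le_add (h.measureReal_laurentBall_one_le hθ) (h.measureReal_laurentBall_zero_le hθ)

end AlmostInvariant

end Affine

section Dilations

open MeasureTheory
open scoped LaurentSeries

variable {R : Type*} [CommRing R] [MeasurableSpace R⸨X⸩] {μ : Measure R⸨X⸩} {z : ℝ} {k m : ℤ}

lemma almostInvariant_mul_inv_pow (hz : 0 ≤ z) (hU : AlmostInvariant μ z (affinePerm k 0))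
    (hV : AlmostInvariant μ z (affinePerm m 1)) (i : ℕ) :
    AlmostInvariant μ (z ^ (i + 1)) (affinePerm (m - i * k) 1) := by
  induction i with
  | zero => simpa using hV
  | succ i ih =>
    have hword : affinePerm (m - (i + 1 : ℕ) * k) (1 : R⸨X⸩) =
        affinePerm (m - i * k) 1 * (affinePerm k 0)⁻¹ := by
      rw [eq_mul_inv_iff_mul_eq, affinePerm_mul]
      congr 1
      · push_cast
        ring
      · simp
    rw [hword, pow_succ]
    exact ih.mul hU.inv (by positivity) hz

lemma almostInvariant_commutator (hz : 0 ≤ z) (hU : AlmostInvariant μ z (affinePerm k 0))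
    (hV : AlmostInvariant μ z (affinePerm m 1)) :
    AlmostInvariant μ (z ^ 4) (affinePerm 0 (1 - .single k 1)) := by
  have hword : affinePerm 0 (1 - .single k 1 : R⸨X⸩) =
      affinePerm m 1 * affinePerm k 0 * (affinePerm k 0 * affinePerm m 1)⁻¹ := by
    rw [eq_mul_inv_iff_mul_eq, affinePerm_mul, affinePerm_mul, affinePerm_mul]
    simp [add_comm k m]
  rw [hword, show z ^ 4 = z * z * (z * z) by ring]
  exact (hV.mul hU hz hz).mul (hU.mul hV hz hz).inv (by positivity) (by positivity)

lemma almostInvariant_conj (hz : 0 ≤ z) (hU : AlmostInvariant μ z (affinePerm k 0))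
    (hV : AlmostInvariant μ z (affinePerm m 1)) :
    AlmostInvariant μ (z ^ 3) (affinePerm k (1 - .single k 1)) := by
  have hword : affinePerm k (1 - .single k 1 : R⸨X⸩) =
      affinePerm m 1 * affinePerm k 0 * (affinePerm m 1)⁻¹ := by
    rw [eq_mul_inv_iff_mul_eq, affinePerm_mul, affinePerm_mul]
    simp [add_comm k m]
  rw [hword, show z ^ 3 = z * z * z by ring]
  exact (hV.mul hU hz hz).mul hV.inv (by positivity) hz

lemma almostInvariant_sq_mul_inv (hz : 0 ≤ z) (hU : AlmostInvariant μ z (affinePerm k 0))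
    (hV : AlmostInvariant μ z (affinePerm m 1)) :
    AlmostInvariant μ (z ^ 3) (affinePerm (2 * k - m) (-.single (2 * k - m) 1)) := by
  have hword : affinePerm (2 * k - m) (-.single (2 * k - m) 1 : R⸨X⸩) =
      affinePerm k 0 * affinePerm k 0 * (affinePerm m 1)⁻¹ := by
    rw [eq_mul_inv_iff_mul_eq, affinePerm_mul, affinePerm_mul]
    simp [two_mul]
  rw [hword, show z ^ 3 = z * z * z by ring]
  exact (hU.mul hU hz hz).mul hV.inv (by positivity) hz

lemma eq_zero_of_quadratic_mul_nonpos {β : ℝ} (hz2 : 1 < z ^ 2 + 2 * z) (hβ : 0 ≤ β)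
    (h : (z ^ 2 + 2 * z - 1) * β ≤ 0) : β = 0 :=
  le_antisymm (nonpos_of_mul_nonpos_right h (by linarith)) hβ

lemma eq_zero_of_overlap {β φ δ : ℝ} (hz : 0 < z) (hz1 : z < 1 / 2) (hz2 : 1 < z ^ 2 + 2 * z)
    (hβ : 0 ≤ β) (hT : φ + δ ≤ (1 - z ^ 4) * β) (hδ : (z + z ^ 3) * β ≤ δ + z ^ 3 * φ)
    (hφ : (z + z ^ 2 + z ^ 3) * β ≤ (1 + z ^ 3) * φ + z ^ 2 * δ) : β = 0 := by
  have hsq : z ^ 2 < 1 / 4 := by nlinarith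
  have hcube : z ^ 3 < 1 / 8 := by nlinarith
  have hfive : z ^ 5 ≤ z ^ 3 := pow_le_pow_of_le_one hz.le (by linarith) (by norm_num)
  have hcube_pos : 0 < z ^ 3 := by positivity
  -- The three multipliers are chosen so that `φ` and `δ` cancel in the sum.
  have hφ' := mul_le_mul_of_nonneg_left hφ (show 0 ≤ 1 - z ^ 3 by linarith)
  have hδ' := mul_le_mul_of_nonneg_left hδ (show 0 ≤ 1 + z ^ 3 - z ^ 2 by linarith)
  have hT' := mul_le_mul_of_nonneg_left hT (show 0 ≤ 1 + z ^ 3 - z ^ 5 by linarith)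
  have hrest₄ : 0 ≤ z ^ 4 * (1 - z) * β :=
    mul_nonneg (mul_nonneg (by positivity) (by linarith)) hβ
  have hrest₇ : 0 ≤ z ^ 7 * (1 - z ^ 2) * β :=
    mul_nonneg (mul_nonneg (by positivity) (by linarith)) hβ
  exact eq_zero_of_quadratic_mul_nonpos hz2 hβ (by linarith)

variable [DiscreteMeasurableSpace R⸨X⸩] [IsFiniteMeasure μ]

-- `laurentBall 1 (m - i * k)` is the disjoint union of an image of the unit ball and of `i` images
-- of its shell `laurentBall 0 0 \ laurentBall 0 k`; the factor `1 - z` sums the geometric series.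
lemma mul_measureReal_laurentBall_one_sub_ge (hz : 0 ≤ z) (hz1 : z ≤ 1) (hk : 0 ≤ k)
    (hU : AlmostInvariant μ z (affinePerm k 0)) (hV : AlmostInvariant μ z (affinePerm m 1))
    (i : ℕ) :
    (1 - z) * z * μ.real (laurentBall 0 0) +
        z ^ 2 * (1 - z ^ i) * (μ.real (laurentBall 0 0) - μ.real (laurentBall 0 k)) ≤
      (1 - z) * μ.real (laurentBall 1 (m - i * k)) := by
  induction i with
  | zero =>
    have h := hV.mul_measureReal_laurentBall_le (p := 0) (i := 0) rfl
    simp only [affinePerm_apply, mul_zero, zero_add] at h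
    have := mul_le_mul_of_nonneg_left h (sub_nonneg.2 hz1)
    simpa [← mul_assoc] using this
  | succ i ih =>
    have h := (almostInvariant_mul_inv_pow hz hU hV (i + 1)).mul_measureReal_laurentBall_sub_le
      (p := 0) (q := 1) (i := 0) (l := k) (by simp [affinePerm_apply]) hk
    rw [zero_add, show k + (m - (i + 1 : ℕ) * k) = m - i * k by push_cast; ring] at h
    have := mul_le_mul_of_nonneg_left h (sub_nonneg.2 hz1)
    linear_combination ih + this

variable [LinearOrder R] [IsStrictOrderedRing R]

lemma measureReal_eq_zero_of_translation_le (hz : 0 < z) (hz1 : z < 1 / 2)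
    (hz2 : 1 < z ^ 2 + 2 * z) (hk : 0 < k) (hU : AlmostInvariant μ z (affinePerm k 0))
    (hV : AlmostInvariant μ z (affinePerm m 1)) {i : ℕ} (hi : i * k < m) {θ : R⸨X⸩}
    (hT : AlmostInvariant μ (z ^ (i + 2)) (affinePerm 0 θ)) (hθ : θ ∈ laurentBall 1 1) :
    μ.real (laurentBall (0 : R⸨X⸩) 0) = 0 := by
  set β := μ.real (laurentBall (0 : R⸨X⸩) 0)
  have hsum := hT.measureReal_laurentBall_one_add_zero_le hθ
  have hladder := mul_measureReal_laurentBall_one_sub_ge hz.le (by linarith) hk.le hU hV i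
  have hx : z * β ≤ μ.real (laurentBall 0 k) := by
    simpa [affinePerm_apply] using hU.mul_measureReal_laurentBall_le (p := 0) (i := 0) rfl
  have hf : μ.real (laurentBall (1 : R⸨X⸩) (m - i * k)) ≤ μ.real (laurentBall 1 1) :=
    measureReal_mono (laurentBall_anti 1 (by lia))
  have hg : μ.real (laurentBall (0 : R⸨X⸩) k) ≤ μ.real (laurentBall 0 1) :=
    measureReal_mono (laurentBall_anti 0 hk)
  have hcoeff : 0 ≤ 1 - z - z ^ 2 * (1 - z ^ i) := by
    have : 0 ≤ z ^ 2 * z ^ i := by positivity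
    nlinarith
  have hmul := mul_le_mul_of_nonneg_left hx hcoeff
  have hsum' := mul_le_mul_of_nonneg_left ((add_le_add hf hg).trans hsum)
    (show 0 ≤ 1 - z by linarith)
  have : (1 - z) * ((z ^ 2 + 2 * z - 1) * β) ≤ 0 := by
    linear_combination hmul + hsum' + hladder
  exact eq_zero_of_quadratic_mul_nonpos hz2 measureReal_nonneg
    (nonpos_of_mul_nonpos_right this (by linarith))

lemma measureReal_eq_zero_of_lt_of_lt (hz : 0 < z) (hz1 : z < 1 / 2) (hz2 : 1 < z ^ 2 + 2 * z)
    (hkm : k < m) (hmk : m < 2 * k) (hU : AlmostInvariant μ z (affinePerm k 0))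
    (hV : AlmostInvariant μ z (affinePerm m 1)) : μ.real (laurentBall (0 : R⸨X⸩) 0) = 0 := by
  have hf {i j : ℤ} (h : i ≤ j) :
      μ.real (laurentBall (1 : R⸨X⸩) j) ≤ μ.real (laurentBall 1 i) :=
    measureReal_mono (laurentBall_anti 1 h)
  have hg {i j : ℤ} (h : i ≤ j) :
      μ.real (laurentBall (0 : R⸨X⸩) j) ≤ μ.real (laurentBall 0 i) :=
    measureReal_mono (laurentBall_anti 0 h)
  have hT := (almostInvariant_commutator hz.le hU hV).measureReal_laurentBall_one_add_zero_le
    (one_sub_single_mem_laurentBall (by lia))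
  have hUB := hU.mul_measureReal_laurentBall_le (p := 0) (q := 0) (i := 0)
    (by simp [affinePerm_apply])
  have hVB := hV.mul_measureReal_laurentBall_le (p := 0) (q := 1) (i := 0)
    (by simp [affinePerm_apply])
  have hshell₁ := (almostInvariant_sq_mul_inv hz.le hU hV).mul_measureReal_laurentBall_sub_le
    (p := 1) (q := 0) (by simp [affinePerm_apply]) zero_le_one
  have hshell₂ := (almostInvariant_mul_inv_pow hz.le hU hV 1).mul_measureReal_laurentBall_sub_le
    (p := 0) (q := 1) (by simp [affinePerm_apply]) zero_le_one
  have hshell₃ := (almostInvariant_conj hz.le hU hV).mul_measureReal_laurentBall_sub_le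
    (p := 1) (q := 1) (by simp [affinePerm_apply]) zero_le_one
  rw [laurentBall_one_zero, zero_add] at hshell₁ hshell₃
  rw [zero_add] at hshell₂ hUB hVB
  rw [Nat.cast_one, one_mul, one_add_one_eq_two] at hshell₂
  refine eq_zero_of_overlap hz hz1 hz2 measureReal_nonneg hT ?_ ?_
  · linarith [hg (show 1 ≤ 2 * k - m by lia), hg (show 1 + (2 * k - m) ≤ k by lia)]
  · linarith [hf (show 1 ≤ m - k by lia), hf (show 1 + (m - k) ≤ k by lia),
      hf (show 1 + k ≤ m by lia)]

theorem measureReal_eq_zero_of_dilations (hz : 0 < z) (hz1 : z < 1 / 2) (hz2 : 1 < z ^ 2 + 2 * z)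
    (hk : 0 < k) (hkm : k ≤ m) (hU : AlmostInvariant μ z (affinePerm k 0))
    (hV : AlmostInvariant μ z (affinePerm m 1)) : μ.real (laurentBall (0 : R⸨X⸩) 0) = 0 := by
  have hword := almostInvariant_mul_inv_pow hz.le hU hV
  rcases hkm.eq_or_lt with rfl | hkm
  · exact measureReal_eq_zero_of_translation_le hz hz1 hz2 hk hU hV (i := 0) (by simpa)
      (by simpa using hword 1) fun _ _ => rfl
  rcases lt_trichotomy m (2 * k) with hmk | rfl | hmk
  · exact measureReal_eq_zero_of_lt_of_lt hz hz1 hz2 hkm hmk hU hV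
  · exact measureReal_eq_zero_of_translation_le hz hz1 hz2 hk hU hV (i := 1) (by simpa)
      (by simpa using hword 2) fun _ _ => rfl
  · exact measureReal_eq_zero_of_translation_le hz hz1 hz2 hk hU hV (i := 2) (by simpa)
      (almostInvariant_commutator hz.le hU hV) (one_sub_single_mem_laurentBall hk)

theorem measureReal_eq_zero_of_translation (hz : 0 ≤ z) (hz2 : 1 < z ^ 2 + 2 * z) (hm : 0 < m)
    (hU : AlmostInvariant μ z (affinePerm 0 1))
    (hV : AlmostInvariant μ z (affinePerm m 0)) : μ.real (laurentBall (0 : R⸨X⸩) 0) = 0 := by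
  have hsum := hU.measureReal_laurentBall_one_add_zero_le fun _ _ => rfl
  have hVB := hV.mul_measureReal_laurentBall_le (p := 0) (q := 0) (i := 0)
    (by simp [affinePerm_apply])
  have hUV := hU.mul hV hz hz
  rw [affinePerm_mul, mul_zero, zero_add, zero_add] at hUV
  have hUVB := hUV.mul_measureReal_laurentBall_le (p := 0) (q := 1) (i := 0)
    (by simp [affinePerm_apply])
  rw [zero_add] at hVB hUVB
  have hf : μ.real (laurentBall (1 : R⸨X⸩) m) ≤ μ.real (laurentBall 1 1) :=
    measureReal_mono (laurentBall_anti 1 hm)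
  have hg : μ.real (laurentBall (0 : R⸨X⸩) m) ≤ μ.real (laurentBall 0 1) :=
    measureReal_mono (laurentBall_anti 0 hm)
  exact eq_zero_of_quadratic_mul_nonpos hz2 measureReal_nonneg (by linarith)

end Dilations

section Conjugation

open scoped LaurentSeries

variable {K : Type*} [Field K] {n k m : ℤ} {b b' c d p : K⸨X⸩}

lemma exists_affinePerm_fixed (hn : n ≠ 0) (b : K⸨X⸩) : ∃ p, affinePerm n b p = p := by
  have hne : (1 - .single n 1 : K⸨X⸩) ≠ 0 := fun h => by
    simpa [HahnSeries.coeff_one, HahnSeries.coeff_single_of_ne hn.symm] using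
      congrArg (HahnSeries.coeff · 0) h
  refine ⟨b / (1 - .single n 1), ?_⟩
  rw [affinePerm_apply]
  field_simp
  ring

/-- The change of coordinate `y ↦ (y - p) / d` of the affine line, with `p` the new origin and `d`
the new unit. -/
noncomputable def coordinateChange (p d : K⸨X⸩) (hd : d ≠ 0) : Equiv.Perm K⸨X⸩ :=
  (Equiv.subRight p).trans (Equiv.divRight₀ d hd)

lemma coordinateChange_mul_affinePerm_mul_inv (hd : d ≠ 0) (h : affinePerm n b p = d * b' + p) :
    coordinateChange p d hd * affinePerm n b * (coordinateChange p d hd)⁻¹ = affinePerm n b' := by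
  rw [mul_inv_eq_iff_eq_mul]
  ext1 y
  change (affinePerm n b y - p) / d = affinePerm n b' ((y - p) / d)
  rw [affinePerm_apply] at h ⊢
  rw [affinePerm_apply]
  field_simp
  linear_combination h

lemma exists_conj_eq_translation (hm : m ≠ 0) (hb : b ≠ 0) (c : K⸨X⸩) :
    ∃ σ : Equiv.Perm K⸨X⸩, σ * affinePerm 0 b * σ⁻¹ = affinePerm 0 1 ∧
      σ * affinePerm m c * σ⁻¹ = affinePerm m 0 := by
  obtain ⟨p, hp⟩ := exists_affinePerm_fixed hm c
  exact ⟨coordinateChange p b hb,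
    coordinateChange_mul_affinePerm_mul_inv hb (by simp [affinePerm_apply, add_comm]),
    coordinateChange_mul_affinePerm_mul_inv hb (by simp [hp])⟩

lemma exists_conj_eq_dilations (hk : k ≠ 0)
    (hcomm : ¬Commute (affinePerm k b) (affinePerm m c)) :
    ∃ σ : Equiv.Perm K⸨X⸩, σ * affinePerm k b * σ⁻¹ = affinePerm k 0 ∧
      σ * affinePerm m c * σ⁻¹ = affinePerm m 1 := by
  obtain ⟨p, hp⟩ := exists_affinePerm_fixed hk b
  have hd : affinePerm m c p - p ≠ 0 := fun h => hcomm <| by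
    rw [affinePerm_apply] at h hp
    have hbc : .single k 1 * c + b = .single m 1 * b + c := by
      linear_combination (.single k 1 - 1) * h + (1 - .single m 1) * hp
    rw [Commute, SemiconjBy, affinePerm_mul, affinePerm_mul, hbc, add_comm]
  exact ⟨coordinateChange p _ hd,
    coordinateChange_mul_affinePerm_mul_inv hd (by simp [hp]),
    coordinateChange_mul_affinePerm_mul_inv hd (by simp)⟩

open MeasureTheory in
lemma exists_conj_measureReal_eq_zero [LinearOrder K] [IsStrictOrderedRing K]
    [MeasurableSpace K⸨X⸩] [DiscreteMeasurableSpace K⸨X⸩] {z : ℝ} (hz : 0 < z) (hz1 : z < 1 / 2)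
    (hz2 : 1 < z ^ 2 + 2 * z) (hk : 0 ≤ k) (hkm : k ≤ m)
    (hcomm : ¬Commute (affinePerm k b) (affinePerm m c)) :
    ∃ σ : Equiv.Perm K⸨X⸩, ∀ μ : Measure K⸨X⸩, IsFiniteMeasure μ →
      AlmostInvariant μ z (σ * affinePerm k b * σ⁻¹) →
      AlmostInvariant μ z (σ * affinePerm m c * σ⁻¹) → μ.real (laurentBall 0 0) = 0 := by
  rcases hk.eq_or_lt with rfl | hk
  · have hb : b ≠ 0 := by
      rintro rfl
      exact hcomm (affinePerm_zero_zero (R := K) ▸ Commute.one_left _)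
    have hm : m ≠ 0 := by
      rintro rfl
      refine hcomm ?_
      rw [Commute, SemiconjBy, affinePerm_mul, affinePerm_mul, HahnSeries.single_zero_one, one_mul,
        one_mul, add_comm b]
    obtain ⟨σ, hσb, hσc⟩ := exists_conj_eq_translation hm hb c
    refine ⟨σ, fun μ _ hU hV => ?_⟩
    rw [hσb] at hU
    rw [hσc] at hV
    exact measureReal_eq_zero_of_translation hz.le hz2 (hkm.lt_of_ne' hm) hU hV
  · obtain ⟨σ, hσb, hσc⟩ := exists_conj_eq_dilations hk.ne' hcomm
    refine ⟨σ, fun μ _ hU hV => ?_⟩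
    rw [hσb] at hU
    rw [hσc] at hV
    exact measureReal_eq_zero_of_dilations hz hz1 hz2 hk hkm hU hV

end Conjugation

section AffineAction

open scoped LaurentSeries

lemma exists_not_commute_map {G H : Type*} [Group G] [Group H] {S : Set G}
    (hS : Subgroup.closure S = ⊤) (f : G →* H) {g h : G} (hcomm : ¬Commute (f g) (f h)) :
    ∃ s ∈ S, ∃ t ∈ S, ¬Commute (f s) (f t) := by
  contrapose! hcomm
  have hmem (g : G) : g ∈ Subgroup.closure S := hS ▸ Subgroup.mem_top g
  exact Subgroup.closure_induction₂ (p := fun g h _ _ => Commute (f g) (f h))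
    (fun s t hs ht => hcomm s hs t ht)
    (fun _ _ => by simp) (fun _ _ => by simp)
    (fun _ _ _ _ _ _ h h' => by simpa using h.mul_left h')
    (fun _ _ _ _ _ _ h h' => by simpa using h.mul_right h')
    (fun _ _ _ _ h => by simpa using h) (fun _ _ _ _ h => by simpa using h) (hmem g) (hmem h)

lemma exists_lt_inv_of_lt_one_add_sqrt_two {ω : ℝ} (h : ω < 1 + √2) :
    ∃ z, 0 < z ∧ z < 1 / 2 ∧ 1 < z ^ 2 + 2 * z ∧ ω < z⁻¹ := by
  obtain ⟨w, hw, hw2⟩ := exists_between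
    (max_lt h (show 2 < 1 + √2 by linarith [sqrt_two_bounds.1]))
  obtain ⟨hωw, h2w⟩ := max_lt_iff.1 hw
  have hw0 : 0 < w := by linarith
  refine ⟨w⁻¹, inv_pos.2 hw0, ?_, ?_, by rwa [inv_inv]⟩
  · rw [one_div]
    exact inv_strictAnti₀ two_pos h2w
  · have hsq : w ^ 2 < 1 + 2 * w := by
      nlinarith [Real.sq_sqrt (zero_le_two (α := ℝ))]
    rw [show w⁻¹ ^ 2 + 2 * w⁻¹ = (1 + 2 * w) / w ^ 2 by field_simp]
    exact (one_lt_div (by positivity)).2 hsq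

variable {R : Type*} [CommRing R] {G : Type*} [Group G] {S : Set G} {s t : G}

lemma exists_affinePerm_nonneg {ρ : G →* Equiv.Perm R⸨X⸩} {n : ℤ} {b : R⸨X⸩}
    (hs : s ∈ S) (h : ρ s = affinePerm n b) (f : Equiv.Perm R⸨X⸩) (hcomm : ¬Commute (ρ s) f) :
    ∃ s' k c, (s' ∈ S ∨ s'⁻¹ ∈ S) ∧ 0 ≤ k ∧ ρ s' = affinePerm k c ∧ ¬Commute (ρ s') f := by
  rcases le_total 0 n with hn | hn
  · exact ⟨s, n, b, .inl hs, hn, h, hcomm⟩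
  · refine ⟨s⁻¹, -n, -(.single (-n) 1 * b), .inr (by rwa [inv_inv]), by lia, ?_, ?_⟩
    · rw [map_inv, h, affinePerm_inv]
    · rwa [map_inv, Commute.inv_left_iff]

lemma exists_not_commute_affinePerm (hS : Subgroup.closure S = ⊤) (ρ : G →* Equiv.Perm R⸨X⸩)
    (hρ : ∀ s ∈ S, ∃ n b, ρ s = affinePerm n b) {g h : G} (hcomm : ¬Commute (ρ g) (ρ h)) :
    ∃ s t k m b c, (s ∈ S ∨ s⁻¹ ∈ S) ∧ (t ∈ S ∨ t⁻¹ ∈ S) ∧ 0 ≤ k ∧ k ≤ m ∧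
      ρ s = affinePerm k b ∧ ρ t = affinePerm m c ∧ ¬Commute (ρ s) (ρ t) := by
  obtain ⟨s, hs, t, ht, hst⟩ := exists_not_commute_map hS ρ hcomm
  obtain ⟨_, _, hρs⟩ := hρ s hs
  obtain ⟨_, _, hρt⟩ := hρ t ht
  obtain ⟨s, k, b, hs, hk, hρs, hst⟩ := exists_affinePerm_nonneg hs hρs _ hst
  obtain ⟨t, m, c, ht, hm, hρt, hts⟩ := exists_affinePerm_nonneg ht hρt _ (mt Commute.symm hst)
  rcases le_total k m with hkm | hmk
  · exact ⟨s, t, k, m, b, c, hs, ht, hk, hkm, hρs, hρt, mt Commute.symm hts⟩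
  · exact ⟨t, s, m, k, c, b, ht, hs, hm, hmk, hρt, hρs, hts⟩

theorem one_add_sqrt_two_le_growthRate {K : Type*} [Field K] [LinearOrder K]
    [IsStrictOrderedRing K] (hf : S.Finite) (hS : Subgroup.closure S = ⊤)
    (ρ : G →* Equiv.Perm K⸨X⸩) (hρ : ∀ s ∈ S, ∃ n b, ρ s = affinePerm n b) {g h : G}
    (hcomm : ¬Commute (ρ g) (ρ h)) : 1 + √2 ≤ growthRate S := by
  by_contra! hlt
  obtain ⟨z, hz, hz1, hz2, hzω⟩ := exists_lt_inv_of_lt_one_add_sqrt_two hlt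
  obtain ⟨s, t, k, m, b, c, hs, ht, hk, hkm, hρs, hρt, hst⟩ :=
    exists_not_commute_affinePerm hS ρ hρ hcomm
  rw [hρs, hρt] at hst
  let : MeasurableSpace K⸨X⸩ := ⊤
  obtain ⟨σ, hσ⟩ := exists_conj_measureReal_eq_zero hz hz1 hz2 hk hkm hst
  let ρσ := (MulAut.conj σ).toMonoidHom.comp ρ
  have hinv {s : G} (hs : s ∈ S ∨ s⁻¹ ∈ S) :
      AlmostInvariant (orbitMeasure S z ρσ 0) z (σ * ρ s * σ⁻¹) :=
    almostInvariant_orbitMeasure ρσ 0 hf hS hz (by linarith) hzω hs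
  exact measureReal_orbitMeasure_ne_zero ρσ 0 hf hS hz hzω
    (E := laurentBall 0 0) (fun _ _ => rfl) <|
    hσ _ (isFiniteMeasure_orbitMeasure ρσ 0 hf hS hz hzω) (hρs ▸ hinv hs) (hρt ▸ hinv ht)

end AffineAction

namespace ZWrZ

open scoped LaurentSeries

/-- The Laurent polynomial whose coefficients are the coordinates of `g`. -/
noncomputable def laurent (g : ZWrZ) : ℚ⸨X⸩ :=
  .ofFinsupp ((conf g).mapRange (↑) Int.cast_zero)

lemma coeff_laurent (g : ZWrZ) (i : ℤ) : (laurent g).coeff i = conf g i := by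
  simp [laurent]

/-- The affine action of `ℤ ≀ ℤ` on Laurent series, in which `t` multiplies by `X` and `a` adds
`1`. -/
noncomputable def affineAction : ZWrZ →* Equiv.Perm ℚ⸨X⸩ where
  toFun g := affinePerm (pos g) (laurent g)
  map_one' := by
    have : laurent 1 = 0 := by
      ext i
      simp [coeff_laurent]
    rw [this, pos_one, affinePerm_zero_zero]
  map_mul' g h := by
    rw [affinePerm_mul, pos_mul]
    congr 1
    ext i
    rw [HahnSeries.coeff_add, HahnSeries.coeff_single_mul, coeff_laurent, coeff_laurent,
      coeff_laurent, conf_mul_apply]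
    push_cast
    ring

lemma affineAction_apply (g : ZWrZ) : affineAction g = affinePerm (pos g) (laurent g) := rfl

lemma not_commute_affineAction : ¬Commute (affineAction a) (affineAction t) := fun h => by
  have hcoeff := congrArg (fun f : Equiv.Perm ℚ⸨X⸩ => (f 0).coeff 0) h.eq
  simp [affineAction_apply, coeff_affinePerm, coeff_laurent] at hcoeff

theorem le_growthRate {S : Set ZWrZ} (hf : S.Finite) (hS : Subgroup.closure S = ⊤) :
    1 + √2 ≤ growthRate S :=
  one_add_sqrt_two_le_growthRate hf hS affineAction (fun _ _ => ⟨_, _, rfl⟩)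
    not_commute_affineAction

end ZWrZ

theorem corollary3 :
    -- `ℤ ≀ ℤ = ⟨a, t ∣ [t ^ k * a * t ^ (-k), a] = 1 (k = 1, 2, …)⟩`
    (∃ e : PresentedGroup ZWrZ.relators ≃* ZWrZ,
      e (PresentedGroup.of 0) = ZWrZ.a ∧ e (PresentedGroup.of 1) = ZWrZ.t) ∧
    -- the limit defining the growth rate exists for every finite generating set
    (∀ S : Set ZWrZ, S.Finite → Subgroup.closure S = ⊤ →
      Tendsto (fun n : ℕ => (growthFunction S n : ℝ) ^ (1 / (n : ℝ))) atTop
        (𝓝 (growthRate S))) ∧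
    -- the minimal growth rate is realized on the generating set `{a, t}` and is `1 + √2`
    Subgroup.closure ({ZWrZ.a, ZWrZ.t} : Set ZWrZ) = ⊤ ∧
    minimalGrowthRate ZWrZ = growthRate ({ZWrZ.a, ZWrZ.t} : Set ZWrZ) ∧
    growthRate ({ZWrZ.a, ZWrZ.t} : Set ZWrZ) = 1 + √2 := by
  have hrate : growthRate ({ZWrZ.a, ZWrZ.t} : Set ZWrZ) = 1 + √2 :=
    le_antisymm ZWrZ.growthRate_a_t_le (ZWrZ.le_growthRate (by simp) ZWrZ.closure_a_t)
  have hmin : IsLeast {r | ∃ S : Set ZWrZ, S.Finite ∧ Subgroup.closure S = ⊤ ∧ growthRate S = r}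
      (growthRate ({ZWrZ.a, ZWrZ.t} : Set ZWrZ)) := by
    refine ⟨⟨_, by simp, ZWrZ.closure_a_t, rfl⟩, ?_⟩
    rintro _ ⟨S, hf, hS, rfl⟩
    exact hrate.trans_le (ZWrZ.le_growthRate hf hS)
  exact ⟨⟨ZWrZ.presentedEquiv, ZWrZ.ofPresented_zero, ZWrZ.ofPresented_one⟩,
    fun S hf hS => tendsto_growthRate hf hS, ZWrZ.closure_a_t, hmin.csInf_eq, hrate⟩
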